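/- Let $R$ be a commutative ring and $t\in R$ (for instance $R=\mathbb{Z}[t]$ with $t$ an indeterminate). A word $u=u_1\cdots u_n$ over the positive integers is packed if its set of letters is $\{1,\dots,r\}$ for some $r\ge 0$; then $\max(u)=r$ and $|u|=n$. Let $A$ be an infinite totally ordered alphabet. The packed word of a word $w$ over $A$ is obtained by replacing each letter by its rank among the distinct letters of $w$. For a packed word $u$, let $\mathbf{M}_u=\mathbf{M}_u(A)$ be the sum of all words over $A$ whose packed word is $u$. Let $\mathbf{WQSym}$ be the free $R$-module with basis $(\mathbf{M}_u)$, where $u$ runs over all packed words, and let $(\mathbf{N}_u)$ be the dual family, so that $\langle F,\mathbf{N}_u\rangle$ is the coefficient of $\mathbf{M}_u$ in $F\in\mathbf{WQSym}$. For packed words $u,v$ of the same length write $v\le u$ if the set composition encoded by $v$ is obtained by merging adjacent blocks of the one encoded by $u$. Let $\omega$ be the $R$-linear endomorphism of $\mathbf{WQSym}$ given by $$\omega\,\mathbf{M}_u=(-1)^{|u|-\max(u)}\sum_{v\le u}\mathbf{M}_v .$$ Let $G$ be a finite simple undirected graph with vertices labelled $1,\dots,n$. For a word $c=c_1\cdots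 c_n$, let $\mathrm{asc}_G(c)$ be the number of edges $\{i,j\}$ of $G$ with $i<j$ and $c_i<c_j$, and let $$\mathbf{X}_G=\sum_{c}t^{\mathrm{asc}_G(c)}\,\mathbf{M}_c\in\mathbf{WQSym},$$ where $c$ runs over the packed words of length $n$ that are proper colorings of $G$ ($c_i\ne c_j$ for every edge $\{i,j\}$). **Proposition.** For every packed word $u$ of length $n$, the coefficient of $\mathbf{M}_u$ in $\omega\mathbf{X}_G$ is $$\langle\omega\mathbf{X}_G,\mathbf{N}_u\rangle=\sum_{\gamma}t^{\mathrm{asc}_G(\gamma,u)},$$ where the sum runs over the acyclic orientations $\gamma$ of $G$ without $u$-descent, that is, without arcs $(i,j)$ such that $u_j<u_i$, and $\mathrm{asc}_G(\gamma,u)$ is the number of arcs $(i,j)$ of $\gamma$ such that $i<j$. -/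

import Mathlib

namespace NCChrom

/-! ### Packed words -/

/-- A word `u` of length `n` over the positive integers is packed if its set of letters is an
initial segment `{1, …, r}` of the positive integers. -/
def IsPacked {n : ℕ} (u : Fin n → ℕ) : Prop :=
  ∀ i, 1 ≤ u i ∧ ∀ k, 1 ≤ k → k ≤ u i → ∃ j, u j = k

/-- Packed words of length `n`. -/
def PackedWord (n : ℕ) : Type := {u : Fin n → ℕ // IsPacked u}

instance (n : ℕ) : CoeFun (PackedWord n) (fun _ => Fin n → ℕ) := ⟨Subtype.val⟩

theorem IsPacked.le {n : ℕ} {u : Fin n → ℕ} (h : IsPacked u) (i : Fin n) : u i ≤ n := by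
  have hsub : Finset.Icc 1 (u i) ⊆ Finset.univ.image u := by
    intro k hk
    rw [Finset.mem_Icc] at hk
    obtain ⟨j, hj⟩ := (h i).2 k hk.1 hk.2
    exact Finset.mem_image.2 ⟨j, Finset.mem_univ _, hj⟩
  have h1 := Finset.card_le_card hsub
  have h2 : (Finset.univ.image u).card ≤ (Finset.univ : Finset (Fin n)).card :=
    Finset.card_image_le
  simp only [Nat.card_Icc, Finset.card_univ, Fintype.card_fin] at h1 h2
  omega

instance (n : ℕ) : Finite (PackedWord n) := by
  refine Finite.of_injective
    (fun u : PackedWord n => fun i => (⟨u i, Nat.lt_succ_of_le (u.2.le i)⟩ : Fin (n + 1))) ?_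
  intro u v h
  apply Subtype.ext
  funext i
  have := congrFun h i
  simpa using this

noncomputable instance (n : ℕ) : Fintype (PackedWord n) := Fintype.ofFinite _

/-- The largest letter of a packed word, i.e. the number of blocks of the set composition that it
encodes (it is `0` for the empty word). -/
def PackedWord.max {n : ℕ} (u : PackedWord n) : ℕ := Finset.univ.sup (u : Fin n → ℕ)

/-- The refinement order: `v ≤ u` if the set composition encoded by `v` is obtained from that
encoded by `u` by merging adjacent blocks, i.e. by relabelling the letters of `u` along a weakly
increasing map. -/
def PackedWord.Coarser {n : ℕ} (v u : PackedWord n) : Prop :=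
  ∃ f : ℕ → ℕ, Monotone f ∧ ∀ i, v i = f (u i)

/-! ### Word quasi-symmetric functions -/

/-- Words over the infinite totally ordered alphabet `A = {a₀ < a₁ < a₂ < ⋯}`, the letter `aₖ`
being written `k`. -/
abbrev Word : Type := Σ n : ℕ, (Fin n → ℕ)

/-- Noncommutative formal power series over the alphabet `A`, given by their coefficients. -/
abbrev NCSeries (R : Type*) : Type _ := Word → R

/-- The letters of the packed word of `w`: each letter is replaced by its rank among the distinct
letters of `w`. -/
def packFun {n : ℕ} (w : Fin n → ℕ) (i : Fin n) : ℕ :=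
  ((Finset.univ.image w).filter (fun a => a ≤ w i)).card

theorem isPacked_packFun {n : ℕ} (w : Fin n → ℕ) : IsPacked (packFun w) := by
  intro i
  refine ⟨Finset.card_pos.2 ⟨w i, by simp⟩, ?_⟩
  intro k hk hki
  -- downward induction on the rank
  obtain ⟨d, hd⟩ := Nat.exists_eq_add_of_le hki
  induction d generalizing k with
  | zero => exact ⟨i, by simpa using hd⟩
  | succ d ih =>
    obtain ⟨j, hj⟩ := ih (k + 1) (by omega) (by omega) (by omega)
    set S := (Finset.univ.image w).filter (fun a => a < w j) with hS
    have hins : (Finset.univ.image w).filter (fun a => a ≤ w j) = insert (w j) S := by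
      ext a
      simp only [hS, Finset.mem_filter, Finset.mem_insert, Finset.mem_image, Finset.mem_univ,
        true_and]
      constructor
      · rintro ⟨h1, h2⟩
        rcases Nat.lt_or_ge a (w j) with h | h
        · exact Or.inr ⟨h1, h⟩
        · exact Or.inl (le_antisymm h2 h)
      · rintro (h | ⟨h1, h2⟩)
        · exact ⟨⟨j, h.symm⟩, h.le⟩
        · exact ⟨h1, h2.le⟩
    have hcard : S.card = k := by
      have h1 : packFun w j = S.card + 1 := by
        rw [packFun, hins, Finset.card_insert_of_notMem (by simp [hS])]
      omega
    have hne : S.Nonempty := Finset.card_pos.1 (by omega)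
    obtain ⟨hm, hlt⟩ := Finset.mem_filter.1 (S.max'_mem hne)
    obtain ⟨l, -, hl⟩ := Finset.mem_image.1 hm
    refine ⟨l, ?_⟩
    rw [← hcard, packFun]
    congr 1
    ext a
    simp only [hS, Finset.mem_filter]
    constructor
    · rintro ⟨h1, h2⟩
      exact ⟨h1, by rw [hl] at h2; exact lt_of_le_of_lt h2 hlt⟩
    · rintro ⟨h1, h2⟩
      refine ⟨h1, ?_⟩
      rw [hl]
      exact S.le_max' a (by rw [hS, Finset.mem_filter]; exact ⟨h1, h2⟩)

/-- Packing of words. -/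
def pack (w : Word) : Σ n : ℕ, PackedWord n := ⟨w.1, packFun w.2, isPacked_packFun w.2⟩

theorem pack_self (u : Σ n : ℕ, PackedWord n) : pack ⟨u.1, u.2.1⟩ = u := by
  obtain ⟨n, u, hu⟩ := u
  have h : packFun u = u := by
    funext i
    have hI : (Finset.univ.image u).filter (fun a => a ≤ u i) = Finset.Icc 1 (u i) := by
      ext a
      simp only [Finset.mem_filter, Finset.mem_image, Finset.mem_univ, true_and, Finset.mem_Icc]
      constructor
      · rintro ⟨⟨j, rfl⟩, h⟩
        exact ⟨(hu j).1, h⟩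
      · rintro ⟨h1, h2⟩
        exact ⟨(hu i).2 a h1 h2, h2⟩
    simp [packFun, hI]
  simp only [pack]
  congr 1
  exact Subtype.ext h

open Classical in
/-- The series `M_u(A)`: the sum of all words over `A` whose packed word is `u`. -/
noncomputable def monomialSeries (R : Type*) [CommRing R] (u : Σ n : ℕ, PackedWord n) :
    NCSeries R :=
  fun w => if pack w = u then 1 else 0

/-- The module `WQSym` of word quasi-symmetric functions: the span of all the `M_u(A)`. -/
def WQSym (R : Type*) [CommRing R] : Submodule R (NCSeries R) :=
  Submodule.span R (Set.range (monomialSeries R))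

theorem linearIndependent_monomialSeries (R : Type*) [CommRing R] :
    LinearIndependent R (monomialSeries R) := by
  classical
  rw [linearIndependent_iff]
  intro l hl
  ext u
  have h := congrFun hl ⟨u.1, u.2.1⟩
  rw [Finsupp.linearCombination_apply, Finsupp.sum, Finset.sum_apply] at h
  simp only [Pi.smul_apply, monomialSeries, pack_self, smul_eq_mul, mul_ite, mul_one, mul_zero,
    Finset.sum_ite_eq, Pi.zero_apply] at h
  by_cases hu : u ∈ l.support
  · simpa [hu] using h
  · simpa using hu

/-- The basis `(M_u)` of `WQSym`, indexed by all packed words. Its coordinate functions are the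
pairings `F ↦ ⟨F, N_u⟩` with the dual basis `(N_u)`. -/
noncomputable def basisM (R : Type*) [CommRing R] :
    Module.Basis (Σ n : ℕ, PackedWord n) R (WQSym R) :=
  Module.Basis.span (linearIndependent_monomialSeries R)

theorem coe_basisM (R : Type*) [CommRing R] (u : Σ n : ℕ, PackedWord n) :
    (basisM R u : NCSeries R) = monomialSeries R u :=
  congrArg Subtype.val (Module.Basis.span_apply (linearIndependent_monomialSeries R) u)

/-- `M_u` as an element of `WQSym`, for a packed word `u` of length `n`. -/
noncomputable def M (R : Type*) [CommRing R] {n : ℕ} (u : PackedWord n) : WQSym R :=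
  basisM R ⟨n, u⟩

/-- The coefficient `⟨F, N_u⟩` of `M_u` in `F ∈ WQSym`. -/
noncomputable def coeffM {R : Type*} [CommRing R] {n : ℕ} (F : WQSym R) (u : PackedWord n) : R :=
  (basisM R).coord ⟨n, u⟩ F

open Classical in
/-- The `ω`-involution of `WQSym`: the linear map such that
`ω M_u = (-1)^(n - r) ∑_{v ≤ u} M_v`, where `n = |u|` and `r = max u` (so `r ≤ n`). -/
noncomputable def omega (R : Type*) [CommRing R] : WQSym R →ₗ[R] WQSym R :=
  (basisM R).constr R (fun u : Σ n : ℕ, PackedWord n =>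
    (-1 : R) ^ (u.1 - u.2.max) •
      ∑ v ∈ Finset.univ.filter (fun v : PackedWord u.1 => v.Coarser u.2), M R v)

/-! ### The noncommutative chromatic quasi-symmetric function -/

/-- `c` is a proper colouring of `G`. -/
def IsProper {n : ℕ} (G : SimpleGraph (Fin n)) (c : Fin n → ℕ) : Prop :=
  ∀ i j, G.Adj i j → c i ≠ c j

open Classical in
/-- `asc_G(c)`: the number of edges `i < j` of `G` such that `c_i < c_j`. -/
noncomputable def asc {n : ℕ} (G : SimpleGraph (Fin n)) (c : Fin n → ℕ) : ℕ :=
  (Finset.univ.filter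
    (fun p : Fin n × Fin n => G.Adj p.1 p.2 ∧ p.1 < p.2 ∧ c p.1 < c p.2)).card

open Classical in
/-- The noncommutative chromatic quasi-symmetric function `X_G`: the sum of `t^{asc_G(c)} M_c` over
the proper packed colourings `c` of `G`. -/
noncomputable def X {R : Type*} [CommRing R] (t : R) {n : ℕ} (G : SimpleGraph (Fin n)) : WQSym R :=
  ∑ c ∈ Finset.univ.filter (fun c : PackedWord n => IsProper G c), t ^ asc G c • M R c

/-! ### Acyclic orientations -/

/-- The set `γ` of arcs is an orientation of `G`: every arc lies on an edge of `G`, and every edge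
of `G` is oriented in exactly one of its two directions. -/
def IsOrientation {n : ℕ} (G : SimpleGraph (Fin n)) (γ : Finset (Fin n × Fin n)) : Prop :=
  (∀ i j, (i, j) ∈ γ → G.Adj i j) ∧ ∀ i j, G.Adj i j → Xor ((i, j) ∈ γ) ((j, i) ∈ γ)

/-- The set `γ` of arcs has no directed cycle. -/
def IsAcyclic {n : ℕ} (γ : Finset (Fin n × Fin n)) : Prop :=
  ∀ i, ¬ Relation.TransGen (fun a b => (a, b) ∈ γ) i i

/-- `γ` has no `u`-descent, i.e. no arc `(i, j)` with `u_j < u_i`. -/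
def NoDescent {n : ℕ} (γ : Finset (Fin n × Fin n)) (u : Fin n → ℕ) : Prop :=
  ∀ i j, (i, j) ∈ γ → ¬ u j < u i

open Classical in
/-- The acyclic orientations of `G` without `u`-descent. -/
noncomputable def acyclicOrientations {n : ℕ} (G : SimpleGraph (Fin n)) (u : Fin n → ℕ) :
    Finset (Finset (Fin n × Fin n)) :=
  Finset.univ.filter (fun γ => IsOrientation G γ ∧ IsAcyclic γ ∧ NoDescent γ u)

/-- The number of increasing arcs of `γ`, i.e. of arcs `(i, j)` of `γ` such that `i < j`. -/
def incArcs {n : ℕ} (γ : Finset (Fin n × Fin n)) : ℕ :=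
  (γ.filter (fun p => p.1 < p.2)).card

end NCChrom

namespace NCChrom

open Finset

/-! ### Signed enumeration of strictly monotone ordered set partitions -/

/-! The coefficient of `M_u` in `ω X_G` is the sum of `t ^ asc G c * (-1) ^ (n - c.max)` over the
proper packed colourings `c` that refine `u` (`coeffM_omega_X`). Group these by the orientation `γ`
directing every edge towards its larger colour; the power of `t` depends only on `γ`. Both refining
`u` and inducing `γ` ask for strict inequalities of `c`, so the fibre over `γ` consists of the
packed words strictly increasing along the relation `P i j` := `(i, j) ∈ γ ∨ u i < u j`. Since `γ`
is acyclic without `u`-descent, `P` has no cycle (`wellFounded_arc_or_lt`). It remains to see that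
the signs of the `P`-increasing packed words add up to `1`, whatever the well-founded `P`
(`sum_packedWord_strict`). This is an induction that strips off the first block
(`sum_strictPartitions`). -/

/-- The nonzero letters of `c` form an initial segment of the positive integers. -/
def IsGapFree {n : ℕ} (c : Fin n → ℕ) : Prop :=
  ∀ i k, 1 ≤ k → k ≤ c i → ∃ j, c j = k

theorem IsGapFree.le {n : ℕ} {c : Fin n → ℕ} (h : IsGapFree c) (i : Fin n) : c i ≤ n := by
  have hsub : Icc 1 (c i) ⊆ univ.image c := by
    intro k hk
    rw [mem_Icc] at hk
    obtain ⟨j, hj⟩ := h i k hk.1 hk.2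
    exact mem_image.2 ⟨j, mem_univ _, hj⟩
  simpa using (card_le_card hsub).trans card_image_le

open Classical in
/-- The ordered set partitions of `S` that strictly increase along the relation `P`, encoded by
words whose letter is `0` outside `S` and the index of the block (counted from `1`) on `S`. -/
noncomputable def strictPartitions {n : ℕ} (P : Fin n → Fin n → Prop) (S : Finset (Fin n)) :
    Finset (Fin n → ℕ) :=
  (Fintype.piFinset fun _ => range (n + 1)).filter fun c =>
    IsGapFree c ∧ (∀ i, i ∈ S ↔ 1 ≤ c i) ∧ ∀ i ∈ S, ∀ j ∈ S, P i j → c i < c j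

/-- The bound `n + 1` in the definition only ensures finiteness: a gap-free word has letters at most
`n`. -/
theorem mem_strictPartitions {n : ℕ} {P : Fin n → Fin n → Prop} {S : Finset (Fin n)}
    {c : Fin n → ℕ} : c ∈ strictPartitions P S ↔
      IsGapFree c ∧ (∀ i, i ∈ S ↔ 1 ≤ c i) ∧ ∀ i ∈ S, ∀ j ∈ S, P i j → c i < c j := by
  simp only [strictPartitions, mem_filter, Fintype.mem_piFinset, mem_range, and_iff_right_iff_imp]
  exact fun h i => Nat.lt_succ_of_le (h.1.le i)

open Classical in
/-- The elements of `S` without `P`-predecessor in `S`. -/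
noncomputable def minimalElements {n : ℕ} (P : Fin n → Fin n → Prop) (S : Finset (Fin n)) :
    Finset (Fin n) :=
  S.filter fun j => ∀ i ∈ S, ¬ P i j

theorem mem_minimalElements {n : ℕ} {P : Fin n → Fin n → Prop} {S : Finset (Fin n)}
    {j : Fin n} : j ∈ minimalElements P S ↔ j ∈ S ∧ ∀ i ∈ S, ¬ P i j := by
  simp [minimalElements]

theorem firstBlock_mem {n : ℕ} {P : Fin n → Fin n → Prop} {S : Finset (Fin n)}
    (hS : S.Nonempty) {c : Fin n → ℕ} (hc : c ∈ strictPartitions P S) :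
    univ.filter (fun i => c i = 1) ∈ (minimalElements P S).powerset.erase ∅ := by
  obtain ⟨hg, hs, hP⟩ := mem_strictPartitions.1 hc
  rw [mem_erase, mem_powerset, ← nonempty_iff_ne_empty]
  constructor
  · obtain ⟨i, hi⟩ := hS
    obtain ⟨j, hj⟩ := hg i 1 le_rfl ((hs i).1 hi)
    exact ⟨j, by simpa using hj⟩
  · intro j hj
    have hj1 : c j = 1 := by simpa using hj
    have hjS := (hs j).2 hj1.ge
    refine mem_minimalElements.2 ⟨hjS, fun i hi hij => ?_⟩
    have h1 := hP i hi j hjS hij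
    have h2 := (hs i).1 hi
    omega

/-- Deleting a first block `B` leaves a strict partition of `S \ B` with one block fewer, whence the
sign. Conversely any nonempty set of minimal elements can be put in front, since no element of `S`
precedes them. -/
theorem sum_firstBlock_eq {n : ℕ} (R : Type*) [CommRing R] {P : Fin n → Fin n → Prop}
    {S B : Finset (Fin n)} (hB : B ∈ (minimalElements P S).powerset.erase ∅) :
    ∑ c ∈ strictPartitions P S with univ.filter (fun i => c i = 1) = B,
        (-1 : R) ^ univ.sup c =
      -∑ c ∈ strictPartitions P (S \ B), (-1 : R) ^ univ.sup c := by
  rw [mem_erase, mem_powerset, ← nonempty_iff_ne_empty] at hB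
  obtain ⟨⟨b, hb⟩, hBm⟩ := hB
  have hBS : ∀ i ∈ B, i ∈ S := fun i hi => (mem_minimalElements.1 (hBm hi)).1
  rw [← sum_neg_distrib]
  -- Truncated subtraction keeps the letter `0` outside `S` and sends `B` to `0`; the inverse raises
  -- only the letters on `S`, so that `B` gets the letter `1`.
  refine sum_bij' (fun c _ i => c i - 1) (fun c _ i => if i ∈ S then c i + 1 else 0)
    ?_ ?_ ?_ ?_ ?_
  · intro c hc
    obtain ⟨hc', rfl⟩ := mem_filter.1 hc
    obtain ⟨hg, hs, hP⟩ := mem_strictPartitions.1 hc'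
    refine mem_strictPartitions.2 ⟨fun i k h1 hk => ?_, fun i => ?_, fun i hi j hj hij => ?_⟩
    · dsimp only at hk
      obtain ⟨j, hj⟩ := hg i (k + 1) (by omega) (by omega)
      exact ⟨j, by simp [hj]⟩
    · simp only [mem_sdiff, mem_filter, mem_univ, true_and, hs i]
      omega
    · simp only [mem_sdiff, mem_filter, mem_univ, true_and] at hi hj
      have h1 := hP i hi.1 j hj.1 hij
      have h2 := (hs i).1 hi.1
      omega
  · intro c hc
    obtain ⟨hg, hs, hP⟩ := mem_strictPartitions.1 hc
    have hbc : c b = 0 := by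
      have := (hs b).not.1 (by simp [hb])
      omega
    refine mem_filter.2 ⟨mem_strictPartitions.2 ⟨fun i k h1 hk => ?_, fun i => ?_,
      fun i hi j hj hij => ?_⟩, ?_⟩
    · rcases h1.eq_or_lt with rfl | h1
      · exact ⟨b, by simp [hBS b hb, hbc]⟩
      · have hki : k ≤ c i + 1 := by
          dsimp only at hk
          split_ifs at hk <;> omega
        obtain ⟨j, hj⟩ := hg i (k - 1) (by omega) (by omega)
        have hjS : j ∈ S := (mem_sdiff.1 ((hs j).2 (by omega))).1
        exact ⟨j, by simp only [hjS, if_true]; omega⟩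
    · split_ifs with h <;> simp [h]
    · simp only [hi, hj, if_true, Nat.add_lt_add_iff_right]
      -- Having the predecessor `i` in `S`, `j` is not minimal. If `i ∈ B`, then `c i = 0 < c j`.
      have hjB : j ∉ B := fun h => (mem_minimalElements.1 (hBm h)).2 i hi hij
      have hj' := mem_sdiff.2 ⟨hj, hjB⟩
      by_cases hiB : i ∈ B
      · have h1 := (hs i).not.1 (by simp [hiB])
        have h2 := (hs j).1 hj'
        omega
      · exact hP i (mem_sdiff.2 ⟨hi, hiB⟩) j hj' hij
    · ext i
      have h := hs i
      have h' := hBS i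
      rw [mem_sdiff] at h
      simp only [mem_filter, mem_univ, true_and]
      split_ifs with hi
      · by_cases hiB : i ∈ B
        · simp only [hiB, not_true, and_false, false_iff] at h
          simp only [hiB, iff_true]
          omega
        · simp only [hi, hiB, not_false_iff, and_true, true_iff] at h
          simp only [hiB, iff_false]
          omega
      · simpa using fun hiB => hi (h' hiB)
  · intro c hc
    obtain ⟨-, hs, -⟩ := mem_strictPartitions.1 (mem_filter.1 hc).1
    funext i
    have h := hs i
    dsimp only
    split_ifs with hi
    · have := h.1 hi
      omega
    · have := h.not.1 hi
      omega
  · intro c hc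
    obtain ⟨-, hs, -⟩ := mem_strictPartitions.1 hc
    funext i
    dsimp only
    split_ifs with hi
    · simp
    · have := (hs i).not.1 (by simp [hi])
      omega
  · intro c hc
    obtain ⟨-, rfl⟩ := mem_filter.1 hc
    have hb1 : c b = 1 := by simpa using hb
    -- The letter `1` at `b` keeps the maximum positive, so truncation loses nothing.
    have hsup : univ.sup c = univ.sup (fun i => c i - 1) + 1 := by
      apply le_antisymm
      · refine Finset.sup_le fun i _ => ?_
        have := le_sup (f := fun i => c i - 1) (mem_univ i)
        omega
      · have h1 := le_sup (f := c) (mem_univ b)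
        have h2 : univ.sup (fun i => c i - 1) ≤ univ.sup c - 1 :=
          Finset.sup_le fun i _ => Nat.sub_le_sub_right (le_sup (f := c) (mem_univ i)) 1
        omega
    rw [hsup, pow_succ, mul_neg_one]

theorem sum_powerset_erase_empty_neg_one_pow {R : Type*} [CommRing R] {α : Type*} [DecidableEq α]
    {s : Finset α} (hs : s.Nonempty) :
    ∑ B ∈ s.powerset.erase ∅, (-1 : R) ^ B.card = -1 := by
  have h := congrArg (Int.cast : ℤ → R) (sum_powerset_neg_one_pow_card_of_nonempty hs)
  push_cast at h
  rw [← add_sum_erase _ _ (empty_mem_powerset s), card_empty, pow_zero] at h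
  linear_combination h

/-- By induction, a first block `B` contributes `-(-1) ^ (|S| - |B|)`. The nonempty sets `B` of
minimal elements have signs `(-1) ^ |B|` adding up to `-1`; well-foundedness provides a minimal
element. -/
theorem sum_strictPartitions {n : ℕ} (R : Type*) [CommRing R] {P : Fin n → Fin n → Prop}
    (hP : WellFounded P) (S : Finset (Fin n)) :
    ∑ c ∈ strictPartitions P S, (-1 : R) ^ univ.sup c = (-1) ^ S.card := by
  induction S using Finset.strongInduction with
  | H S ih =>
    rcases S.eq_empty_or_nonempty with rfl | hS
    · have h0 : strictPartitions P ∅ = {0} := by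
        ext c
        simp only [mem_strictPartitions, mem_singleton]
        constructor
        · rintro ⟨-, hs, -⟩
          funext i
          simpa using hs i
        · rintro rfl
          exact ⟨fun i k h1 hk => by simp at hk; omega, by simp, by simp⟩
      rw [h0, sum_singleton, card_empty]
      congr 1
      exact Nat.le_zero.1 (Finset.sup_le fun i _ => le_rfl)
    · have hmin : (minimalElements P S).Nonempty := by
        obtain ⟨m, hm, h⟩ := hP.has_min (S : Set (Fin n)) hS
        exact ⟨m, mem_minimalElements.2 ⟨hm, fun i hi => h i hi⟩⟩
      rw [← sum_fiberwise_of_maps_to (fun c hc => firstBlock_mem hS hc)]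
      have hterm : ∀ B ∈ (minimalElements P S).powerset.erase ∅,
          ∑ c ∈ strictPartitions P S with univ.filter (fun i => c i = 1) = B,
            (-1 : R) ^ univ.sup c = -(-1) ^ S.card * (-1) ^ B.card := by
        intro B hB
        rw [sum_firstBlock_eq R hB]
        rw [mem_erase, mem_powerset, ← nonempty_iff_ne_empty] at hB
        have hBS : B ⊆ S := fun i hi => (mem_minimalElements.1 (hB.2 hi)).1
        rw [ih _ (sdiff_ssubset hBS hB.1), neg_mul]
        have hc := card_sdiff_add_card_eq_card hBS
        rw [← hc, pow_add, mul_assoc, ← mul_pow, neg_one_mul, neg_neg, one_pow, mul_one]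
      rw [sum_congr rfl hterm, ← mul_sum, sum_powerset_erase_empty_neg_one_pow hmin]
      ring

/-! ### Packed words -/

theorem mem_strictPartitions_univ {n : ℕ} {P : Fin n → Fin n → Prop} {c : Fin n → ℕ} :
    c ∈ strictPartitions P univ ↔ IsPacked c ∧ ∀ i j, P i j → c i < c j := by
  simp only [mem_strictPartitions, mem_univ, true_iff, true_implies, IsPacked, IsGapFree,
    forall_and]
  tauto

theorem PackedWord.max_le {n : ℕ} (c : PackedWord n) : c.max ≤ n :=
  Finset.sup_le fun i _ => c.2.le i

open Classical in
theorem sum_packedWord_strict {n : ℕ} (R : Type*) [CommRing R] {P : Fin n → Fin n → Prop}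
    (hP : WellFounded P) :
    ∑ c : PackedWord n with ∀ i j, P i j → c i < c j, (-1 : R) ^ (n - c.max) = 1 := by
  have h : ∑ c : PackedWord n with ∀ i j, P i j → c i < c j, (-1 : R) ^ c.max = (-1) ^ n := by
    have h' := sum_strictPartitions R hP univ
    rw [card_univ, Fintype.card_fin] at h'
    rw [← h']
    refine sum_bij (fun c _ => c.1) ?_ ?_ ?_ ?_
    · exact fun c hc => mem_strictPartitions_univ.2 ⟨c.2, (mem_filter.1 hc).2⟩
    · exact fun _ _ _ _ h => Subtype.ext h
    · intro c hc
      obtain ⟨h1, h2⟩ := mem_strictPartitions_univ.1 hc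
      exact ⟨⟨c, h1⟩, mem_filter.2 ⟨mem_univ _, h2⟩, rfl⟩
    · exact fun _ _ => rfl
  have hsign : ∀ c : PackedWord n, (-1 : R) ^ (n - c.max) = (-1) ^ n * (-1) ^ c.max := by
    intro c
    have hn : (-1 : R) ^ n = (-1) ^ (n - c.max) * (-1) ^ c.max := by
      rw [← pow_add, Nat.sub_add_cancel c.max_le]
    rw [hn, mul_assoc, ← mul_pow, neg_one_mul, neg_neg, one_pow, mul_one]
  rw [sum_congr rfl fun c _ => hsign c, ← mul_sum, h, ← mul_pow, neg_one_mul, neg_neg, one_pow]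

/-- In this form, refining `u` is a strictness condition of the same kind as increasing along arcs.
-/
theorem PackedWord.coarser_iff {n : ℕ} {u c : PackedWord n} :
    u.Coarser c ↔ ∀ i j, u i < u j → c i < c j := by
  constructor
  · rintro ⟨f, hf, h⟩ i j hij
    rw [h, h] at hij
    exact hf.reflect_lt hij
  · intro h
    -- The least monotone candidate: `k` goes to the largest `u j` with `c j ≤ k`, or to `0` if
    -- there is none.
    refine ⟨fun k => (univ.filter fun j => c j ≤ k).sup u.1, fun a b hab => ?_, fun i => ?_⟩
    · exact sup_mono fun j hj => by
        simp only [mem_filter, mem_univ, true_and] at hj ⊢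
        exact hj.trans hab
    · apply le_antisymm
      · exact le_sup (f := u.1) (by simp)
      · refine Finset.sup_le fun j hj => ?_
        by_contra hlt
        have := h i j (not_le.1 hlt)
        simp only [mem_filter, mem_univ, true_and] at hj
        omega

/-! ### The orientation induced by a colouring -/

open Classical in
/-- The arcs `(i, j)` on the edges of `G` with `c_i < c_j`. -/
noncomputable def inducedArcs {n : ℕ} (G : SimpleGraph (Fin n)) (c : Fin n → ℕ) :
    Finset (Fin n × Fin n) :=
  univ.filter fun p => G.Adj p.1 p.2 ∧ c p.1 < c p.2

theorem mem_inducedArcs {n : ℕ} {G : SimpleGraph (Fin n)} {c : Fin n → ℕ} {i j : Fin n} :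
    (i, j) ∈ inducedArcs G c ↔ G.Adj i j ∧ c i < c j := by
  simp [inducedArcs]

theorem asc_eq_incArcs_inducedArcs {n : ℕ} (G : SimpleGraph (Fin n)) (c : Fin n → ℕ) :
    asc G c = incArcs (inducedArcs G c) := by
  unfold asc incArcs inducedArcs
  rw [filter_filter]
  congr 1
  ext p
  simp only [mem_filter]
  tauto

theorem isAcyclic_of_strictMono {n : ℕ} {γ : Finset (Fin n × Fin n)} {c : Fin n → ℕ}
    (h : ∀ i j, (i, j) ∈ γ → c i < c j) : IsAcyclic γ := by
  have key : ∀ i j, Relation.TransGen (fun a b => (a, b) ∈ γ) i j → c i < c j := by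
    intro i j hij
    induction hij with
    | single h1 => exact h _ _ h1
    | tail _ h1 ih => exact ih.trans (h _ _ h1)
  exact fun i hi => (key i i hi).false

theorem mem_acyclicOrientations {n : ℕ} {G : SimpleGraph (Fin n)} {u : Fin n → ℕ}
    {γ : Finset (Fin n × Fin n)} : γ ∈ acyclicOrientations G u ↔
      IsOrientation G γ ∧ IsAcyclic γ ∧ NoDescent γ u := by
  simp [acyclicOrientations]

theorem inducedArcs_mem_acyclicOrientations {n : ℕ} {G : SimpleGraph (Fin n)}
    {u c : PackedWord n} (hc : IsProper G c) (huc : u.Coarser c) :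
    inducedArcs G c ∈ acyclicOrientations G u := by
  refine mem_acyclicOrientations.2 ⟨⟨fun i j h => (mem_inducedArcs.1 h).1, fun i j h => ?_⟩,
    isAcyclic_of_strictMono fun i j h => (mem_inducedArcs.1 h).2, fun i j h hu => ?_⟩
  · have hne := hc i j h
    simp only [mem_inducedArcs, h, h.symm, true_and]
    rcases lt_or_gt_of_ne hne with h1 | h1
    · exact Or.inl ⟨h1, h1.asymm⟩
    · exact Or.inr ⟨h1, h1.asymm⟩
  · exact (mem_inducedArcs.1 h).2.asymm (PackedWord.coarser_iff.1 huc j i hu)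

/-- As `γ` already holds one direction of every edge, increasing along it excludes both equal
colours and the opposite arc. -/
theorem IsOrientation.inducedArcs_eq_iff {n : ℕ} {G : SimpleGraph (Fin n)}
    {γ : Finset (Fin n × Fin n)} (hγ : IsOrientation G γ) {c : Fin n → ℕ} :
    IsProper G c ∧ inducedArcs G c = γ ↔ ∀ i j, (i, j) ∈ γ → c i < c j := by
  constructor
  · rintro ⟨-, rfl⟩ i j h
    exact (mem_inducedArcs.1 h).2
  · intro h
    refine ⟨fun i j hij => ?_, ?_⟩
    · rcases hγ.2 i j hij with ⟨h1, -⟩ | ⟨h1, -⟩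
      · exact (h _ _ h1).ne
      · exact (h _ _ h1).ne'
    · ext ⟨i, j⟩
      rw [mem_inducedArcs]
      refine ⟨fun ⟨hij, hlt⟩ => ?_, fun hij => ⟨hγ.1 i j hij, h i j hij⟩⟩
      rcases hγ.2 i j hij with ⟨h1, -⟩ | ⟨h1, -⟩
      · exact h1
      · exact absurd (h _ _ h1) hlt.asymm

/-- An acyclic orientation without `u`-descent remains acyclic when all the arcs `(i, j)` with
`u_i < u_j` are added to it. -/
theorem wellFounded_arc_or_lt {n : ℕ} {γ : Finset (Fin n × Fin n)} {u : Fin n → ℕ}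
    (hγ : IsAcyclic γ) (hu : NoDescent γ u) :
    WellFounded fun i j => (i, j) ∈ γ ∨ u i < u j := by
  -- Along a path `u` weakly increases; if it stays constant, every step is an arc of `γ`. A cycle
  -- would thus lie in `γ`.
  have key : ∀ i j, Relation.TransGen (fun i j => (i, j) ∈ γ ∨ u i < u j) i j →
      u i < u j ∨ u i = u j ∧ Relation.TransGen (fun a b => (a, b) ∈ γ) i j := by
    have step : ∀ i j, (i, j) ∈ γ ∨ u i < u j →
        u i < u j ∨ u i = u j ∧ (i, j) ∈ γ := by
      rintro i j (h | h)
      · exact (not_lt.1 (hu i j h)).lt_or_eq.imp id fun h' => ⟨h', h⟩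
      · exact Or.inl h
    intro i j hij
    induction hij with
    | single h => exact (step _ _ h).imp id fun h' => ⟨h'.1, .single h'.2⟩
    | tail _ h ih =>
      rcases ih with ih | ⟨ih, ih'⟩ <;> rcases step _ _ h with h | ⟨h, h'⟩
      · exact Or.inl (ih.trans h)
      · exact Or.inl (h ▸ ih)
      · exact Or.inl (ih ▸ h)
      · exact Or.inr ⟨ih.trans h, ih'.tail h'⟩
  have : Std.Irrefl (Relation.TransGen fun i j => (i, j) ∈ γ ∨ u i < u j) :=
    ⟨fun i hi => (key i i hi).elim (lt_irrefl _) fun h => hγ i h.2⟩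
  have : IsTrans _ (Relation.TransGen fun i j => (i, j) ∈ γ ∨ u i < u j) := ⟨fun _ _ _ => .trans⟩
  exact (Finite.wellFounded_of_trans_of_irrefl
    (Relation.TransGen fun i j => (i, j) ∈ γ ∨ u i < u j)).mono fun _ _ h => Relation.TransGen.single h

/-! ### The coefficients of `ω X_G` -/

theorem coeffM_M {R : Type*} [CommRing R] {n : ℕ} (v u : PackedWord n) [Decidable (v = u)] :
    coeffM (M R v) u = if v = u then 1 else 0 := by
  classical
  rw [coeffM, M, Module.Basis.coord_apply, Module.Basis.repr_self, Finsupp.single_apply]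
  simp

open Classical in
theorem coeffM_omega_M {R : Type*} [CommRing R] {n : ℕ} (c u : PackedWord n) :
    coeffM (omega R (M R c)) u = if u.Coarser c then (-1) ^ (n - c.max) else 0 := by
  have h : omega R (M R c) = (-1 : R) ^ (n - c.max) •
      ∑ v ∈ univ.filter (fun v : PackedWord n => v.Coarser c), M R v :=
    (basisM R).constr_basis R _ _
  have h' : ∀ v : PackedWord n, (basisM R).coord ⟨n, u⟩ (M R v) = if v = u then 1 else 0 :=
    fun v => coeffM_M v u
  rw [h, coeffM, map_smul, map_sum]
  simp only [h', sum_ite_eq', mem_filter, mem_univ, true_and, smul_eq_mul, mul_ite, mul_one,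
    mul_zero]

open Classical in
theorem coeffM_omega_X {R : Type*} [CommRing R] (t : R) {n : ℕ} (G : SimpleGraph (Fin n))
    (u : PackedWord n) :
    coeffM (omega R (X t G)) u =
      ∑ c ∈ univ.filter (fun c : PackedWord n => IsProper G c ∧ u.Coarser c),
        t ^ asc G c * (-1) ^ (n - c.max) := by
  have h : ∀ c : PackedWord n, (basisM R).coord ⟨n, u⟩ (omega R (M R c)) =
      if u.Coarser c then (-1) ^ (n - c.max) else 0 := fun c => coeffM_omega_M c u
  rw [coeffM, X, map_sum, map_sum, ← filter_filter, 
    sum_filter (s := univ.filter fun c : PackedWord n => IsProper G c)]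
  simp only [map_smul, h, smul_eq_mul, mul_ite, mul_zero]

open Classical in
theorem sum_colorings_inducing {R : Type*} [CommRing R] (t : R) {n : ℕ}
    {G : SimpleGraph (Fin n)} {u : PackedWord n} {γ : Finset (Fin n × Fin n)}
    (hγ : γ ∈ acyclicOrientations G u) :
    ∑ c ∈ (univ.filter fun c : PackedWord n => IsProper G c ∧ u.Coarser c).filter
        (fun c : PackedWord n => inducedArcs G c = γ), t ^ asc G c * (-1) ^ (n - c.max) = t ^ incArcs γ := by
  obtain ⟨ho, ha, hd⟩ := mem_acyclicOrientations.1 hγ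
  have hfilter : ∀ c : PackedWord n, (IsProper G c ∧ u.Coarser c) ∧ inducedArcs G c = γ ↔
      ∀ i j, (i, j) ∈ γ ∨ u i < u j → c i < c j := by
    intro c
    -- Properness is absorbed into the condition of inducing `γ`.
    rw [and_right_comm, ho.inducedArcs_eq_iff, PackedWord.coarser_iff]
    simp only [or_imp, forall_and]
  have hasc : ∀ c ∈ univ.filter (fun c : PackedWord n =>
      (IsProper G c ∧ u.Coarser c) ∧ inducedArcs G c = γ),
      t ^ asc G c * (-1 : R) ^ (n - c.max) = t ^ incArcs γ * (-1) ^ (n - c.max) := by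
    intro c hc
    rw [asc_eq_incArcs_inducedArcs, (mem_filter.1 hc).2.2]
  have hsum := sum_packedWord_strict R (wellFounded_arc_or_lt ha hd)
  rw [filter_filter, sum_congr rfl hasc, ← mul_sum]
  refine Eq.trans (congrArg _ (Eq.trans ?_ hsum)) (mul_one _)
  exact sum_congr (by ext c; simp only [mem_filter, hfilter]) fun _ _ => rfl

end NCChrom

theorem mainTheorem5 {R : Type*} [CommRing R] (t : R) {n : ℕ} (G : SimpleGraph (Fin n))
    (u : NCChrom.PackedWord n) :
    NCChrom.coeffM (NCChrom.omega R (NCChrom.X t G)) u =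
      ∑ γ ∈ NCChrom.acyclicOrientations G u, t ^ NCChrom.incArcs γ := by
  classical
  rw [NCChrom.coeffM_omega_X,
    ← Finset.sum_fiberwise_of_maps_to (g := fun c : NCChrom.PackedWord n => NCChrom.inducedArcs G c)
      (t := NCChrom.acyclicOrientations G u) fun c hc =>
      NCChrom.inducedArcs_mem_acyclicOrientations (Finset.mem_filter.1 hc).2.1
        (Finset.mem_filter.1 hc).2.2]
  exact Finset.sum_congr rfl fun γ hγ => NCChrom.sum_colorings_inducing t hγ
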